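/- Let $X$ be a complex Banach space and let $(T(t))_{t\ge 0}$ be a $C_0$ semigroup of bounded linear operators on $X$ with infinitesimal generator $A$. A closed linear operator $S$ on $X$ with null space $N(S)$ and range $R(S)$ is called upper semi-Fredholm if $\dim N(S)<\infty$ and $R(S)$ is closed, lower semi-Fredholm if $\operatorname{codim} R(S)<\infty$, and Fredholm if it is both. Let $\sigma_{uf}(S)$, $\sigma_{lf}(S)$ and $\sigma_{e}(S)$ denote the sets of all $\lambda\in\mathbb{C}$ for which $S-\lambda I$ is not upper semi-Fredholm, not lower semi-Fredholm, and not Fredholm, respectively. Suppose that there exists $t_0>0$ such that $AT(t_0)$ is a bounded operator on $X$. Then for every $t>0$ $$\sigma_{uf}(T(t))\setminus\{0\}=\{e^{\lambda t}:\lambda\in\sigma_{uf}(A)\}.$$ If, in addition, $X$ is reflexive, then for every $t>0$ $$\sigma_{lf}(T(t))\setminus\{0\}=\{e^{\lambda t}:\lambda\in\sigma_{lf}(A)\}\quad\text{and}\quad \sigma_{e}(T(t))\setminus\{0\}=\{e^{\lambda t}:\lambda\in\sigma_{e}(A)\}.$$ -/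

import Mathlib

open Filter Topology
open scoped NNReal

noncomputable section

/-- A `C₀` (strongly continuous) semigroup of bounded linear operators on a complex normed space. -/
structure C0Semigroup (X : Type*) [NormedAddCommGroup X] [NormedSpace ℂ X] where
  /-- The operators `T(t)`, `t ≥ 0`. -/
  op : ℝ≥0 → X →L[ℂ] X
  op_zero : op 0 = ContinuousLinearMap.id ℂ X
  op_add : ∀ s t : ℝ≥0, op (s + t) = (op s).comp (op t)
  tendsto_zero : ∀ x : X, Tendsto (fun t : ℝ≥0 => op t x) (𝓝[>] 0) (𝓝 x)

namespace C0Semigroup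

variable {X : Type*} [NormedAddCommGroup X] [NormedSpace ℂ X] (T : C0Semigroup X)

/-- `y` is the right derivative at `0` of the orbit of `x`, that is,
`y = lim_{h → 0+} (T(h) x - x) / h`. -/
def HasGenerator (x y : X) : Prop :=
  Tendsto (fun h : ℝ≥0 => (((h : ℝ) : ℂ))⁻¹ • (T.op h x - x)) (𝓝[>] 0) (𝓝 y)

theorem HasGenerator.unique {x y z : X} (hy : T.HasGenerator x y) (hz : T.HasGenerator x z) :
    y = z :=
  tendsto_nhds_unique hy hz

theorem HasGenerator.add {x y x' y' : X} (h : T.HasGenerator x y) (h' : T.HasGenerator x' y') :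
    T.HasGenerator (x + x') (y + y') := by
  refine (Tendsto.add h h').congr fun s => ?_
  rw [← smul_add, map_add]
  congr 1
  abel

theorem HasGenerator.smul (c : ℂ) {x y : X} (h : T.HasGenerator x y) :
    T.HasGenerator (c • x) (c • y) := by
  refine (Tendsto.const_smul h c).congr fun s => ?_
  rw [map_smul, ← smul_sub, smul_comm]

theorem HasGenerator.zero : T.HasGenerator 0 0 := by
  simp [HasGenerator]

/-- The infinitesimal generator of the semigroup: its domain consists of all `x` for which
`lim_{h → 0+} (T(h) x - x) / h` exists, and its value at such an `x` is that limit. -/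
def generator : X →ₗ.[ℂ] X where
  domain :=
    { carrier := {x | ∃ y, T.HasGenerator x y}
      add_mem' := fun ⟨_, h⟩ ⟨_, h'⟩ => ⟨_, h.add T h'⟩
      zero_mem' := ⟨0, HasGenerator.zero T⟩
      smul_mem' := fun c _ ⟨_, h⟩ => ⟨_, h.smul T c⟩ }
  toFun :=
    { toFun := fun x => x.2.choose
      map_add' := fun x x' =>
        (x + x').2.choose_spec.unique T (x.2.choose_spec.add T x'.2.choose_spec)
      map_smul' := fun c x => (c • x).2.choose_spec.unique T (x.2.choose_spec.smul T c) }

theorem mem_generator_domain {x : X} : x ∈ T.generator.domain ↔ ∃ y, T.HasGenerator x y :=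
  Iff.rfl

theorem generator_spec (x : T.generator.domain) : T.HasGenerator x (T.generator x) :=
  x.2.choose_spec

end C0Semigroup

namespace LinearPMap

variable {X : Type*} [NormedAddCommGroup X] [NormedSpace ℂ X]

/-- The operator `A - c I`, with the same domain as `A`. -/
def subScalar (A : X →ₗ.[ℂ] X) (c : ℂ) : X →ₗ.[ℂ] X where
  domain := A.domain
  toFun := A.toFun - c • A.domain.subtype

/-- Upper semi-Fredholm: the null space is finite-dimensional and the range is closed.
(Used for closed operators `A`.) -/
def IsUpperSemiFredholm (A : X →ₗ.[ℂ] X) : Prop :=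
  FiniteDimensional ℂ (LinearMap.ker A.toFun) ∧
    _root_.IsClosed (LinearMap.range A.toFun : Set X)

/-- Lower semi-Fredholm: the range has finite codimension. (Used for closed operators `A`.) -/
def IsLowerSemiFredholm (A : X →ₗ.[ℂ] X) : Prop :=
  FiniteDimensional ℂ (X ⧸ LinearMap.range A.toFun)

/-- Fredholm: both upper and lower semi-Fredholm. (Used for closed operators `A`.) -/
def IsFredholmOperator (A : X →ₗ.[ℂ] X) : Prop :=
  A.IsUpperSemiFredholm ∧ A.IsLowerSemiFredholm

/-- The upper semi-Fredholm spectrum. -/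
def upperSemiFredholmSpectrum (A : X →ₗ.[ℂ] X) : Set ℂ :=
  {c | ¬ (A.subScalar c).IsUpperSemiFredholm}

/-- The lower semi-Fredholm spectrum. -/
def lowerSemiFredholmSpectrum (A : X →ₗ.[ℂ] X) : Set ℂ :=
  {c | ¬ (A.subScalar c).IsLowerSemiFredholm}

/-- The essential (Fredholm) spectrum. -/
def essentialSpectrum (A : X →ₗ.[ℂ] X) : Set ℂ :=
  {c | ¬ (A.subScalar c).IsFredholmOperator}

end LinearPMap

/-- A bounded operator, regarded as an operator with domain the whole space. -/
def ContinuousLinearMap.toFullPMap {X : Type*} [NormedAddCommGroup X] [NormedSpace ℂ X]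
    (S : X →L[ℂ] X) : X →ₗ.[ℂ] X :=
  (S : X →ₗ[ℂ] X).toPMap ⊤

/-- A normed space is reflexive if the canonical embedding into its bidual is onto. -/
def IsReflexiveSpace (X : Type*) [NormedAddCommGroup X] [NormedSpace ℂ X] : Prop :=
  Function.Surjective (NormedSpace.inclusionInDoubleDual ℂ X)

end

/-! Two sequential criteria carry the proof. Between Banach spaces, an operator has
finite-dimensional kernel and closed range exactly when every bounded sequence with null image has
totally bounded range (`isSequentiallyProper_iff`); its range has finite codimension exactly when
its dual has this property (`isSequentiallyProper_dualOperator_iff`). Both apply to A - c, seen as a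
bounded operator on its graph, which is complete.

Put J_c = ∫₀ᵗ e^{-cs} T(s) ds. Then e^{-ct} T(t) - 1 equals (A - c) J_c, and also J_c (A - c) on the
domain of A. Hence each Fredholm property passes from T(t) - e^{ct} to A - c.

Conversely, let μ = e^{ct} and suppose that all A - c_k have the property, where c_k = c + 2πik/t
runs over the solutions of e^{zt} = μ. Boundedness of A T(t₀) makes the semigroup norm continuous
from t₀ on. So for a ≥ t₀ the operator T(a), the value at s = 0 of e^{-cs} T(a + s), lies in the
norm-closed span of the Fourier coefficients of that function on [0, t], which are (1/t) J_{c_k}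
T(a) (`op_mem_closure_span`). If (x_n) is bounded and (T(t) - μ) x_n → 0, each sequence J_{c_k} T(a)
x_n is totally bounded, hence so is T(a) x_n. For a = mt, T(a) x_n - μ^m x_n → 0, so (x_n) is
totally bounded. Functionals l_n composed with these operators give the lower case. -/

/-! ### Sequences with totally bounded range. -/

section TotallyBoundedRange

variable {E F : Type*} [NormedAddCommGroup E] [NormedAddCommGroup F]

theorem Bornology.IsBounded.exists_forall_range_norm_le {x : ℕ → E}
    (h : Bornology.IsBounded (Set.range x)) : ∃ C, 0 < C ∧ ∀ n, ‖x n‖ ≤ C := by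
  obtain ⟨C, hC, h⟩ := h.exists_pos_norm_le
  exact ⟨C, hC, fun n => h _ ⟨n, rfl⟩⟩

theorem isBounded_range_of_norm_le {x : ℕ → E} (C : ℝ) (h : ∀ n, ‖x n‖ ≤ C) :
    Bornology.IsBounded (Set.range x) :=
  isBounded_iff_forall_norm_le.2 ⟨C, by rintro _ ⟨n, rfl⟩; exact h n⟩

theorem ContinuousLinearMap.isBounded_range_comp [NormedSpace ℂ E] [NormedSpace ℂ F] (f : E →L[ℂ] F) {x : ℕ → E}
    (h : Bornology.IsBounded (Set.range x)) :
    Bornology.IsBounded (Set.range fun n => f (x n)) := by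
  obtain ⟨C, -, hC⟩ := h.exists_forall_range_norm_le
  exact isBounded_range_of_norm_le (‖f‖ * C) fun n =>
    (f.le_opNorm _).trans (mul_le_mul_of_nonneg_left (hC n) (norm_nonneg _))

theorem ContinuousLinearMap.totallyBounded_range_comp [NormedSpace ℂ E] [NormedSpace ℂ F]
    (f : E →L[ℂ] F) {x : ℕ → E}
    (h : TotallyBounded (Set.range x)) : TotallyBounded (Set.range fun n => f (x n)) := by
  have := h.image f.uniformContinuous
  rwa [← Set.range_comp] at this

theorem totallyBounded_range_prod {x : ℕ → E} {y : ℕ → F} (hx : TotallyBounded (Set.range x))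
    (hy : TotallyBounded (Set.range y)) : TotallyBounded (Set.range fun n => (x n, y n)) := by
  rw [totallyBounded_iff_ultrafilter] at hx hy ⊢
  intro f hf
  have hf' : ∀ᶠ p in (f : Filter (E × F)), p ∈ Set.range fun n => (x n, y n) :=
    le_principal_iff.1 hf
  rw [cauchy_prod_iff]
  constructor
  · refine hx (f.map Prod.fst) (le_principal_iff.2 (mem_map.2 (hf'.mono ?_)))
    rintro _ ⟨n, rfl⟩
    exact ⟨n, rfl⟩
  · refine hy (f.map Prod.snd) (le_principal_iff.2 (mem_map.2 (hf'.mono ?_)))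
    rintro _ ⟨n, rfl⟩
    exact ⟨n, rfl⟩

theorem totallyBounded_range_add [NormedSpace ℂ E]
    {x y : ℕ → E} (hx : TotallyBounded (Set.range x))
    (hy : TotallyBounded (Set.range y)) : TotallyBounded (Set.range fun n => x n + y n) :=
  (ContinuousLinearMap.fst ℂ E E + ContinuousLinearMap.snd ℂ E E).totallyBounded_range_comp
    (totallyBounded_range_prod hx hy)

theorem Filter.Tendsto.totallyBounded_range {x : ℕ → E} {a : E} (h : Tendsto x atTop (𝓝 a)) :
    TotallyBounded (Set.range x) :=
  h.cauchySeq.totallyBounded_range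

theorem totallyBounded_range_of_sub_tendsto_zero [NormedSpace ℂ E]
    {x y : ℕ → E}
    (hy : TotallyBounded (Set.range y)) (h : Tendsto (fun n => x n - y n) atTop (𝓝 0)) :
    TotallyBounded (Set.range x) := by
  simpa using totallyBounded_range_add h.totallyBounded_range hy

theorem totallyBounded_range_of_finiteDimensional [NormedSpace ℂ E]
    [FiniteDimensional ℂ E] {x : ℕ → E}
    (h : Bornology.IsBounded (Set.range x)) : TotallyBounded (Set.range x) :=
  haveI := FiniteDimensional.proper ℂ E
  h.isCompact_closure.totallyBounded.subset subset_closure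

theorem totallyBounded_range_of_antilipschitz [NormedSpace ℂ E] [NormedSpace ℂ F]
    {f : E →L[ℂ] F} {K : ℝ≥0}
    (hf : AntilipschitzWith K f) {x : ℕ → E} (h : TotallyBounded (Set.range fun n => f (x n))) :
    TotallyBounded (Set.range x) := by
  refine (totallyBounded_image_iff (hf.isUniformInducing f.uniformContinuous)).1 ?_
  rwa [← Set.range_comp]

theorem exists_subseq_tendsto_of_totallyBounded_range [CompleteSpace E] {x : ℕ → E}
    (h : TotallyBounded (Set.range x)) :
    ∃ a, ∃ φ : ℕ → ℕ, StrictMono φ ∧ Tendsto (x ∘ φ) atTop (𝓝 a) := by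
  have hc : IsCompact (closure (Set.range x)) := h.closure.isCompact_of_isClosed isClosed_closure
  obtain ⟨a, -, φ, hφ, ha⟩ := hc.tendsto_subseq fun n => subset_closure ⟨n, rfl⟩
  exact ⟨a, φ, hφ, ha⟩

end TotallyBoundedRange

/-! ### Sequential criterion for finite-dimensional kernel and closed range. -/

namespace ContinuousLinearMap

variable {E F : Type*} [NormedAddCommGroup E] [NormedSpace ℂ E] [NormedAddCommGroup F]
  [NormedSpace ℂ F]

/-- Every bounded sequence that `f` sends to a null sequence has totally bounded range. -/
def IsSequentiallyProper (f : E →L[ℂ] F) : Prop :=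
  ∀ x : ℕ → E, Bornology.IsBounded (Set.range x) → Tendsto (fun n => f (x n)) atTop (𝓝 0) →
    TotallyBounded (Set.range x)

/-- Riesz: sequences in the unit ball of the kernel have null image, so that ball is compact. -/
theorem finiteDimensional_ker_of_isSequentiallyProper [CompleteSpace E] {f : E →L[ℂ] F}
    (h : f.IsSequentiallyProper) : FiniteDimensional ℂ (LinearMap.ker (f : E →ₗ[ℂ] F)) := by
  have : CompleteSpace (LinearMap.ker (f : E →ₗ[ℂ] F)) := f.isClosed_ker.completeSpace_coe
  refine FiniteDimensional.of_isCompact_closedBall₀ ℂ zero_lt_one ?_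
  rw [isCompact_iff_isSeqCompact]
  intro x hx
  have hb : ∀ n, ‖(x n : E)‖ ≤ 1 := fun n => by simpa using hx n
  have htb : TotallyBounded (Set.range fun n => (x n : E)) := by
    refine h _ (isBounded_range_of_norm_le 1 hb) ?_
    have : ∀ n, f (x n : E) = 0 := fun n => (x n).2
    simp [this]
  have htb' : TotallyBounded (Set.range x) :=
    totallyBounded_range_of_antilipschitz (f := (LinearMap.ker (f : E →ₗ[ℂ] F)).subtypeL)
      (K := 1) (AntilipschitzWith.of_le_mul_dist fun a b => by simp [Subtype.dist_eq]) htb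
  obtain ⟨a, φ, hφ, ha⟩ := exists_subseq_tendsto_of_totallyBounded_range htb'
  exact ⟨a, Metric.isClosed_closedBall.mem_of_tendsto ha (Eventually.of_forall fun n => hx _),
    φ, hφ, ha⟩

theorem exists_norm_one_tendsto_zero_of_not_bounded_below {f : E →L[ℂ] F}
    (h : ¬ ∃ K, AntilipschitzWith K f) :
    ∃ x : ℕ → E, (∀ n, ‖x n‖ = 1) ∧ Tendsto (fun n => f (x n)) atTop (𝓝 0) := by
  have key : ∀ n : ℕ, ∃ x : E, ‖x‖ = 1 ∧ ‖f x‖ ≤ 1 / ((n : ℝ) + 1) := by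
    intro n
    by_contra! hn
    refine h ⟨(n : ℝ≥0) + 1, f.antilipschitz_of_bound fun x => ?_⟩
    by_cases hx : x = 0
    · simp [hx]
    have hx' : 0 < ‖x‖ := norm_pos_iff.2 hx
    have := hn (((‖x‖ : ℂ))⁻¹ • x) (by rw [norm_smul]; simp [hx'.ne'])
    rw [map_smul, norm_smul, norm_inv, Complex.norm_real, norm_norm, inv_mul_eq_div,
      div_lt_div_iff₀ (by positivity) hx'] at this
    push_cast
    linarith
  choose x hx hfx using key
  exact ⟨x, hx, squeeze_zero_norm hfx tendsto_one_div_add_atTop_nhds_zero_nat⟩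

/-- On a closed complement `M` of the kernel, `f` is bounded below: otherwise unit vectors of `M`
with null image would accumulate at a unit vector of `M` in the kernel. -/
theorem isClosed_range_of_isSequentiallyProper [CompleteSpace E] {f : E →L[ℂ] F}
    (h : f.IsSequentiallyProper) :
    IsClosed (LinearMap.range (f : E →ₗ[ℂ] F) : Set F) := by
  have := finiteDimensional_ker_of_isSequentiallyProper h
  obtain ⟨M, hMc, hM⟩ := (Submodule.ClosedComplemented.of_finiteDimensional (𝕜 := ℂ)
    (LinearMap.ker (f : E →ₗ[ℂ] F))).exists_isClosed_isCompl
  have : CompleteSpace M := hMc.completeSpace_coe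
  let g : M →L[ℂ] F := f.comp M.subtypeL
  have hg : ∃ K, AntilipschitzWith K g := by
    by_contra hg
    obtain ⟨x, hx, hgx⟩ := exists_norm_one_tendsto_zero_of_not_bounded_below hg
    have htb := h (fun n => (x n : E)) (isBounded_range_of_norm_le 1 fun n => (hx n).le) hgx
    obtain ⟨a, φ, hφ, ha⟩ := exists_subseq_tendsto_of_totallyBounded_range htb
    have haM : a ∈ M := hMc.mem_of_tendsto ha (Eventually.of_forall fun n => (x (φ n)).2)
    have hfa : f a = 0 :=
      tendsto_nhds_unique ((f.continuous.tendsto a).comp ha) (hgx.comp hφ.tendsto_atTop)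
    have ha0 : a = 0 := by
      have : a ∈ LinearMap.ker (f : E →ₗ[ℂ] F) ⊓ M := ⟨hfa, haM⟩
      rwa [hM.inf_eq_bot] at this
    have h1 : Tendsto (fun n => ‖(x (φ n) : E)‖) atTop (𝓝 ‖a‖) := ha.norm
    have h2 : ∀ n, ‖(x (φ n) : E)‖ = 1 := fun n => hx _
    simp only [h2] at h1
    have := tendsto_nhds_unique h1 tendsto_const_nhds
    simp [ha0] at this
  obtain ⟨K, hK⟩ := hg
  have hcl := hK.isClosed_range g.uniformContinuous
  convert hcl using 1
  ext y
  constructor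
  · rintro ⟨x, rfl⟩
    obtain ⟨u, hu, v, hv, rfl⟩ := Submodule.mem_sup.1
      (show x ∈ LinearMap.ker (f : E →ₗ[ℂ] F) ⊔ M by rw [hM.sup_eq_top]; trivial)
    refine ⟨⟨v, hv⟩, ?_⟩
    have : f u = 0 := hu
    simp [g, this]
  · rintro ⟨x, rfl⟩
    exact ⟨x, rfl⟩

/-- The open mapping theorem onto the range gives null preimages `u n` of `f (x n)`; the remainders
`x n - u n` are bounded in the finite-dimensional kernel. -/
theorem isSequentiallyProper_of_isClosed_range [CompleteSpace E] [CompleteSpace F] {f : E →L[ℂ] F}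
    (hker : FiniteDimensional ℂ (LinearMap.ker (f : E →ₗ[ℂ] F)))
    (hran : IsClosed (LinearMap.range (f : E →ₗ[ℂ] F) : Set F)) : f.IsSequentiallyProper := by
  intro x hx hfx
  have : CompleteSpace (LinearMap.range (f : E →ₗ[ℂ] F)) := hran.completeSpace_coe
  let g : E →L[ℂ] LinearMap.range (f : E →ₗ[ℂ] F) :=
    f.codRestrict _ fun x => LinearMap.mem_range_self _ x
  have hgs : Function.Surjective g := by
    rintro ⟨_, x, rfl⟩
    exact ⟨x, rfl⟩
  obtain ⟨C, hC, H⟩ := g.exists_preimage_norm_le hgs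
  choose u hu hun using fun n => H (g (x n))
  have hu0 : Tendsto u atTop (𝓝 0) := by
    refine squeeze_zero_norm hun ?_
    have : Tendsto (fun n => C * ‖f (x n)‖) atTop (𝓝 (C * ‖(0 : F)‖)) := hfx.norm.const_mul C
    rw [norm_zero, mul_zero] at this
    exact this
  have hv : ∀ n, x n - u n ∈ LinearMap.ker (f : E →ₗ[ℂ] F) := fun n => by
    have : f (u n) = f (x n) := congrArg Subtype.val (hu n)
    simp [this]
  have hvb : Bornology.IsBounded
      (Set.range fun n => (⟨x n - u n, hv n⟩ : LinearMap.ker (f : E →ₗ[ℂ] F))) := by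
    obtain ⟨C₁, -, h₁⟩ := hx.exists_forall_range_norm_le
    obtain ⟨C₂, -, h₂⟩ := (hu0.totallyBounded_range).isBounded.exists_forall_range_norm_le
    exact isBounded_range_of_norm_le (C₁ + C₂) fun n =>
      (norm_sub_le _ _).trans (add_le_add (h₁ n) (h₂ n))
  have hvt := (LinearMap.ker (f : E →ₗ[ℂ] F)).subtypeL.totallyBounded_range_comp
    (totallyBounded_range_of_finiteDimensional hvb)
  exact totallyBounded_range_of_sub_tendsto_zero hvt (by simpa using hu0)

/-- A bounded operator between Banach spaces has finite-dimensional kernel and closed range if and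
only if it is sequentially proper. -/
theorem isSequentiallyProper_iff [CompleteSpace E] [CompleteSpace F] {f : E →L[ℂ] F} :
    f.IsSequentiallyProper ↔ FiniteDimensional ℂ (LinearMap.ker (f : E →ₗ[ℂ] F)) ∧
      IsClosed (LinearMap.range (f : E →ₗ[ℂ] F) : Set F) :=
  ⟨fun h => ⟨finiteDimensional_ker_of_isSequentiallyProper h,
    isClosed_range_of_isSequentiallyProper h⟩,
    fun h => isSequentiallyProper_of_isClosed_range h.1 h.2⟩

end ContinuousLinearMap

/-! ### Duality criterion for a range of finite codimension. -/

namespace ContinuousLinearMap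

variable {E F : Type*} [NormedAddCommGroup E] [NormedSpace ℂ E] [NormedAddCommGroup F]
  [NormedSpace ℂ F]

/-- The iteration from the open mapping theorem: residuals halve at each step, so the approximate
preimages sum to an exact one. -/
theorem surjective_of_forall_exists_norm_sub_le_half [CompleteSpace E] (f : E →L[ℂ] F) {C : ℝ}
    (h : ∀ y, ∃ x, ‖y - f x‖ ≤ 1 / 2 * ‖y‖ ∧ ‖x‖ ≤ C * ‖y‖) : Function.Surjective f := by
  intro y
  choose g hg hgC using h
  let r : ℕ → F := fun n => (fun z => z - f (g z))^[n] y
  have hr_succ : ∀ n, r (n + 1) = r n - f (g (r n)) := fun n =>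
    Function.iterate_succ_apply' _ _ _
  have hr : ∀ n, ‖r n‖ ≤ (1 / 2) ^ n * ‖y‖ := by
    intro n
    induction n with
    | zero => simp [r]
    | succ n ih =>
      rw [hr_succ, pow_succ', mul_assoc]
      exact (hg _).trans (by gcongr)
  have hu : ∀ n, ‖g (r n)‖ ≤ (1 / 2) ^ n * (|C| * ‖y‖) := fun n =>
    calc ‖g (r n)‖ ≤ C * ‖r n‖ := hgC _
      _ ≤ |C| * ((1 / 2) ^ n * ‖y‖) := by gcongr; exacts [le_abs_self C, hr n]
      _ = _ := by ring
  have hsum : Summable fun n => g (r n) :=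
    .of_norm_bounded ((summable_geometric_of_lt_one (by norm_num) (by norm_num)).mul_right _) hu
  have hpart : ∀ n, f (∑ i ∈ Finset.range n, g (r i)) = y - r n := by
    intro n
    induction n with
    | zero => simp [r]
    | succ n ih => rw [Finset.sum_range_succ, map_add, ih, hr_succ]; abel
  have hr0 : Tendsto r atTop (𝓝 0) := by
    refine squeeze_zero_norm hr ?_
    simpa using (tendsto_pow_atTop_nhds_zero_of_lt_one (r := (1 / 2 : ℝ)) (by norm_num)
      (by norm_num)).mul_const ‖y‖
  refine ⟨∑' n, g (r n), tendsto_nhds_unique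
    ((f.continuous.tendsto _).comp hsum.hasSum.tendsto_sum_nat) ?_⟩
  have : Tendsto (fun n => y - r n) atTop (𝓝 (y - 0)) := hr0.const_sub y
  simpa [Function.comp_def, hpart] using this

/-- The dual (transposed) operator of a bounded operator. -/
noncomputable def dualOperator (f : E →L[ℂ] F) : (F →L[ℂ] ℂ) →L[ℂ] (E →L[ℂ] ℂ) :=
  precomp ℂ f

@[simp]
theorem dualOperator_apply (f : E →L[ℂ] F) (l : F →L[ℂ] ℂ) : dualOperator f l = l.comp f :=
  rfl

/-- If the dual map of `f` is bounded below, then `f` is onto. -/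
theorem surjective_of_antilipschitz_dualOperator [CompleteSpace E] (f : E →L[ℂ] F) {K : ℝ≥0}
    (h : AntilipschitzWith K (dualOperator f)) : Function.Surjective f := by
  have hK : ∀ l : F →L[ℂ] ℂ, ‖l‖ ≤ K * ‖l.comp f‖ := fun l => by
    simpa using h.le_mul_dist l 0
  refine f.surjective_of_forall_exists_norm_sub_le_half (C := K + 1) fun y => ?_
  by_cases hy : y = 0
  · exact ⟨0, by simp [hy]⟩
  have hy' : 0 < ‖y‖ := norm_pos_iff.2 hy
  -- `K + 1` keeps the radius positive when `K = 0`; below, `K / (K + 1) ≤ 1` contradicts the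
  -- separation of `y` from the image of the ball.
  let R : ℝ := (K + 1) * ‖y‖
  have hR : 0 < R := by positivity
  let s : Set F := f '' Metric.closedBall 0 R
  have hs : Convex ℝ s :=
    (convex_closedBall (0 : E) R).linear_image ((f : E →ₗ[ℂ] F).restrictScalars ℝ)
  have hmem : y ∈ closure s := by
    by_contra hns
    obtain ⟨l, u, hlu, hul⟩ := RCLike.geometric_hahn_banach_closed_point (𝕜 := ℂ) hs.closure
      isClosed_closure hns
    have hbound : ∀ x : E, ‖x‖ ≤ R → ‖l (f x)‖ ≤ u := by
      intro x hx
      -- A unimodular factor turns the bound on real parts into a bound on norms.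
      obtain ⟨c, hc, hcx⟩ := RCLike.exists_norm_eq_mul_self (l (f x))
      have h1 := hlu (f (c • x)) (subset_closure ⟨_, by simpa [norm_smul, hc] using hx, rfl⟩)
      rw [map_smul, map_smul, smul_eq_mul, ← hcx] at h1
      simpa using h1.le
    have hu : 0 ≤ u := (norm_nonneg _).trans (hbound 0 (by simpa using hR.le))
    have hnorm : ‖l.comp f‖ ≤ u / R :=
      opNorm_bound_of_ball_bound hR u _ fun x hx => hbound x (by simpa using hx)
    have h1 : RCLike.re (l y) ≤ u := calc
      RCLike.re (l y) ≤ ‖l y‖ := RCLike.re_le_norm _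
      _ ≤ ‖l‖ * ‖y‖ := l.le_opNorm y
      _ ≤ K * (u / R) * ‖y‖ := by gcongr; exact (hK l).trans (by gcongr)
      _ = u * (K / (K + 1)) := by simp only [R]; field_simp
      _ ≤ u * 1 := by gcongr; exact div_le_one_of_le₀ (by linarith) (by positivity)
      _ = u := mul_one u
    exact absurd hul h1.not_gt
  obtain ⟨_, ⟨x, hx, rfl⟩, hxy⟩ := Metric.mem_closure_iff.1 hmem (1 / 2 * ‖y‖) (by positivity)
  exact ⟨x, by rw [← dist_eq_norm]; exact hxy.le, by simpa using hx⟩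

theorem exists_antilipschitz_dualOperator_of_surjective [CompleteSpace E] [CompleteSpace F]
    {f : E →L[ℂ] F} (hf : Function.Surjective f) : ∃ K, AntilipschitzWith K (dualOperator f) := by
  obtain ⟨C, hC, H⟩ := f.exists_preimage_norm_le hf
  refine ⟨⟨C, hC.le⟩, (dualOperator f).antilipschitz_of_bound fun l => ?_⟩
  refine l.opNorm_le_bound (by positivity) fun y => ?_
  obtain ⟨x, rfl, hx⟩ := H y
  calc ‖l (f x)‖ ≤ ‖l.comp f‖ * ‖x‖ := (l.comp f).le_opNorm x
    _ ≤ ‖l.comp f‖ * (C * ‖f x‖) := by gcongr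
    _ = C * ‖l.comp f‖ * ‖f x‖ := by ring

/-- Adjoining a finite-dimensional complement of the range makes `f` onto, so the enlarged dual is
bounded below. Its two components are `l ∘ f`, which tends to zero, and the restriction of `l` to
the complement, bounded in finite dimension. -/
theorem isSequentiallyProper_dualOperator [CompleteSpace E] [CompleteSpace F]
    {f : E →L[ℂ] F} (h : FiniteDimensional ℂ (F ⧸ LinearMap.range (f : E →ₗ[ℂ] F))) :
    (dualOperator f).IsSequentiallyProper := by
  intro l hl hfl
  obtain ⟨E₀, hE₀⟩ := Submodule.exists_isCompl (LinearMap.range (f : E →ₗ[ℂ] F))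
  have : FiniteDimensional ℂ E₀ :=
    (Submodule.quotientEquivOfIsCompl _ _ hE₀).finiteDimensional
  have : CompleteSpace E₀ := FiniteDimensional.complete ℂ E₀
  let Q : E × E₀ →L[ℂ] F := f.coprod E₀.subtypeL
  have hQ : Function.Surjective Q := by
    intro y
    obtain ⟨_, ⟨x, rfl⟩, v, hv, rfl⟩ := Submodule.mem_sup.1
      (show y ∈ LinearMap.range (f : E →ₗ[ℂ] F) ⊔ E₀ by rw [hE₀.sup_eq_top]; trivial)
    exact ⟨(x, ⟨v, hv⟩), by simp [Q]⟩
  obtain ⟨K, hK⟩ := exists_antilipschitz_dualOperator_of_surjective hQ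
  refine totallyBounded_range_of_antilipschitz hK ?_
  have h1 := (dualOperator (fst ℂ E E₀)).totallyBounded_range_comp hfl.totallyBounded_range
  have h2 := (dualOperator (snd ℂ E E₀)).totallyBounded_range_comp
    (totallyBounded_range_of_finiteDimensional
      ((dualOperator E₀.subtypeL).isBounded_range_comp hl))
  convert totallyBounded_range_add h1 h2 using 3 with n
  ext x <;> simp [Q]

/-- `E₀` is a linear lift of the image of `W` under evaluation at a basis of `N`: every `w` agrees
with some element of `E₀` under all functionals coming from `N`. -/
theorem _root_.LinearMap.exists_finiteDimensional_separating {V W : Type*} [AddCommGroup V]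
    [Module ℂ V] [AddCommGroup W] [Module ℂ W] (B : V →ₗ[ℂ] W →ₗ[ℂ] ℂ) (N : Submodule ℂ V)
    [FiniteDimensional ℂ N] : ∃ E₀ : Submodule ℂ W, FiniteDimensional ℂ E₀ ∧
      ∀ l ∈ N, (∀ w ∈ E₀, B l w = 0) → B l = 0 := by
  let b := Module.finBasis ℂ N
  let ev : W →ₗ[ℂ] (Fin (Module.finrank ℂ N) → ℂ) := LinearMap.pi fun i => B (b i : V)
  obtain ⟨g, hg⟩ := ev.rangeRestrict.exists_rightInverse_of_surjective ev.range_rangeRestrict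
  refine ⟨LinearMap.range g, inferInstance, fun l hl' h0 => ?_⟩
  ext w
  have h1 : ev (g (ev.rangeRestrict w)) = ev w :=
    congrArg Subtype.val (LinearMap.congr_fun hg (ev.rangeRestrict w))
  have hl : ∀ v, B l v = ∑ i, b.repr ⟨l, hl'⟩ i * B (b i : V) v := fun v => by
    have := congrArg (fun m : N => B (m : V) v) (b.sum_repr ⟨l, hl'⟩)
    rw [← this]
    simp [-Module.Basis.sum_repr]
  have h2 : B l (g (ev.rangeRestrict w)) = B l w := by
    rw [hl, hl]
    exact Finset.sum_congr rfl fun i _ => congrArg (b.repr ⟨l, hl'⟩ i * ·) (congrFun h1 i)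
  rw [← h2, h0 _ ⟨_, rfl⟩, LinearMap.zero_apply]

/-- Adjoin a finite-dimensional `E₀` that separates the kernel of the dual. The enlarged dual is
then bounded below, so the enlarged operator is onto and `E₀` spans the quotient. -/
theorem finiteDimensional_quotient_range_of_isSequentiallyProper_dualOperator [CompleteSpace E]
    {f : E →L[ℂ] F} (h : (dualOperator f).IsSequentiallyProper) :
    FiniteDimensional ℂ (F ⧸ LinearMap.range (f : E →ₗ[ℂ] F)) := by
  have := finiteDimensional_ker_of_isSequentiallyProper h
  obtain ⟨E₀, hE₀, hsep⟩ := LinearMap.exists_finiteDimensional_separating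
    (coeLM ℂ : (F →L[ℂ] ℂ) →ₗ[ℂ] F →ₗ[ℂ] ℂ)
    (LinearMap.ker (dualOperator f : (F →L[ℂ] ℂ) →ₗ[ℂ] (E →L[ℂ] ℂ)))
  have : CompleteSpace E₀ := FiniteDimensional.complete ℂ E₀
  let Q : E × E₀ →L[ℂ] F := f.coprod E₀.subtypeL
  have hQ : ∃ K, AntilipschitzWith K (dualOperator Q) := by
    by_contra hQ
    obtain ⟨l, hl, hQl⟩ := exists_norm_one_tendsto_zero_of_not_bounded_below hQ
    have h1 : Tendsto (fun n => dualOperator f (l n)) atTop (𝓝 0) := by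
      have := ((dualOperator (inl ℂ E E₀)).continuous.tendsto _).comp hQl
      rw [map_zero] at this
      refine this.congr fun n => ?_
      ext x
      simp [Q]
    have h2 : Tendsto (fun n => dualOperator E₀.subtypeL (l n)) atTop (𝓝 0) := by
      have := ((dualOperator (inr ℂ E E₀)).continuous.tendsto _).comp hQl
      rw [map_zero] at this
      refine this.congr fun n => ?_
      ext x
      simp [Q]
    obtain ⟨a, φ, hφ, ha⟩ := exists_subseq_tendsto_of_totallyBounded_range
      (h l (isBounded_range_of_norm_le 1 fun n => (hl n).le) h1)
    have h3 : dualOperator f a = 0 := tendsto_nhds_unique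
      (((dualOperator f).continuous.tendsto a).comp ha) (h1.comp hφ.tendsto_atTop)
    have h4 : dualOperator E₀.subtypeL a = 0 := tendsto_nhds_unique
      (((dualOperator E₀.subtypeL).continuous.tendsto a).comp ha) (h2.comp hφ.tendsto_atTop)
    have ha0 : a = 0 := coe_injective (hsep a h3 fun v hv => by
      simpa using congrArg (fun m => m (⟨v, hv⟩ : E₀)) h4)
    have h5 : Tendsto (fun n => ‖l (φ n)‖) atTop (𝓝 ‖a‖) := ha.norm
    simp only [hl] at h5
    have := tendsto_nhds_unique h5 tendsto_const_nhds
    simp [ha0] at this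
  obtain ⟨K, hK⟩ := hQ
  have hQs := surjective_of_antilipschitz_dualOperator Q hK
  refine Module.Finite.of_surjective
    ((LinearMap.range (f : E →ₗ[ℂ] F)).mkQ ∘ₗ E₀.subtype) fun q => ?_
  obtain ⟨y, rfl⟩ := Submodule.mkQ_surjective _ q
  obtain ⟨⟨x, v⟩, rfl⟩ := hQs y
  refine ⟨v, ?_⟩
  have : (LinearMap.range (f : E →ₗ[ℂ] F)).mkQ (f x) = 0 := by simp
  simp only [Q, coprod_apply, map_add, this, zero_add]
  rfl

/-- The range of a bounded operator between Banach spaces has finite codimension if and only if the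
dual operator is sequentially proper. -/
theorem isSequentiallyProper_dualOperator_iff [CompleteSpace E] [CompleteSpace F]
    {f : E →L[ℂ] F} : (dualOperator f).IsSequentiallyProper ↔
      FiniteDimensional ℂ (F ⧸ LinearMap.range (f : E →ₗ[ℂ] F)) :=
  ⟨finiteDimensional_quotient_range_of_isSequentiallyProper_dualOperator,
    isSequentiallyProper_dualOperator⟩

end ContinuousLinearMap

/-! ### Orbits, their integrals, and closedness of the generator. -/

namespace C0Semigroup

variable {X : Type*} [NormedAddCommGroup X] [NormedSpace ℂ X] (T : C0Semigroup X)

@[simp]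
theorem op_zero_apply (x : X) : T.op 0 x = x := by
  rw [T.op_zero, ContinuousLinearMap.id_apply]

theorem op_add_apply (s t : ℝ≥0) (x : X) : T.op (s + t) x = T.op s (T.op t x) := by
  rw [T.op_add, ContinuousLinearMap.comp_apply]

theorem op_comm (s t : ℝ≥0) (x : X) : T.op s (T.op t x) = T.op t (T.op s x) := by
  rw [← op_add_apply, add_comm, op_add_apply]

theorem op_nsmul (n : ℕ) (t : ℝ≥0) : T.op (n • t) = T.op t ^ n := by
  induction n with
  | zero => rw [zero_nsmul, T.op_zero, pow_zero]; rfl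
  | succ n ih => rw [succ_nsmul, T.op_add, ih, pow_succ]; rfl

theorem tendsto_op_nhds_zero (x : X) : Tendsto (fun t => T.op t x) (𝓝 0) (𝓝 x) := by
  have h : ContinuousWithinAt (fun t => T.op t x) (Set.Ioi 0) 0 := by
    simpa [ContinuousWithinAt] using T.tendsto_zero x
  rw [continuousWithinAt_Ioi_iff_Ici, show Set.Ici (0 : ℝ≥0) = Set.univ from Set.Ici_bot,
    continuousWithinAt_univ] at h
  simpa [ContinuousAt] using h

theorem HasGenerator.op {x y : X} (h : T.HasGenerator x y) (t : ℝ≥0) :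
    T.HasGenerator (T.op t x) (T.op t y) := by
  refine (((T.op t).continuous.tendsto y).comp h).congr fun s => ?_
  simp [T.op_comm s t]

/-- Factoring out the earlier time treats left and right continuity together. -/
theorem norm_op_sub_op (s t : ℝ≥0) (x : X) :
    ‖T.op s x - T.op t x‖ = ‖T.op (min s t) (T.op (nndist s t) x - x)‖ := by
  wlog h : s ≤ t generalizing s t
  · rw [norm_sub_rev, this t s (le_of_not_ge h), min_comm, nndist_comm]
  · obtain ⟨d, rfl⟩ := exists_add_of_le h
    have : nndist s (s + d) = d := by
      rw [NNReal.nndist_eq, tsub_eq_zero_of_le h, add_tsub_cancel_left, max_eq_right zero_le]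
    rw [this, min_eq_left h, map_sub, ← op_add_apply, norm_sub_rev]

theorem _root_.NNReal.tendsto_coe_nhdsGT_zero :
    Tendsto (fun r : ℝ≥0 => (r : ℝ)) (𝓝[>] 0) (𝓝[≠] 0) := by
  refine tendsto_nhdsWithin_iff.2 ⟨?_, ?_⟩
  · exact (NNReal.continuous_coe.tendsto 0).mono_left nhdsWithin_le_nhds
  · filter_upwards [self_mem_nhdsWithin] with r hr
    simpa using (show (0 : ℝ≥0) < r from hr).ne'

theorem _root_.HasDerivAt.tendsto_complex_slope {f : ℝ → X} {a : ℝ} {f' : X}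
    (h : HasDerivAt f f' a) :
    Tendsto (fun r : ℝ≥0 => (((r : ℝ) : ℂ))⁻¹ • (f (a + r) - f a)) (𝓝[>] 0) (𝓝 f') := by
  refine ((hasDerivAt_iff_tendsto_slope_zero.1 h).comp NNReal.tendsto_coe_nhdsGT_zero).congr
    fun r => ?_
  rw [← Complex.ofReal_inv, Complex.coe_smul]
  rfl

/-- The graph of the infinitesimal generator, as a subspace of `X × X`. -/
def generatorGraph : Submodule ℂ (X × X) where
  carrier := {p | T.HasGenerator p.1 p.2}
  add_mem' h h' := HasGenerator.add T h h'
  zero_mem' := HasGenerator.zero T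
  smul_mem' c _ h := HasGenerator.smul T c h

theorem mem_generatorGraph {p : X × X} : p ∈ T.generatorGraph ↔ T.HasGenerator p.1 p.2 :=
  Iff.rfl

theorem continuous_op_add_of_le {a b : ℝ≥0} (hab : a ≤ b)
    (h : Continuous fun s => T.op (a + s)) : Continuous fun s => T.op (b + s) := by
  obtain ⟨d, rfl⟩ := exists_add_of_le hab
  simp_rw [add_assoc]
  exact h.comp (continuous_const.add continuous_id)

theorem norm_integral_op_le {M : ℝ} {h : ℝ≥0} (hM : ∀ s ≤ h, ‖T.op s‖ ≤ M) (x : X) :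
    ‖∫ s in (0 : ℝ)..h, T.op s.toNNReal x‖ ≤ h * M * ‖x‖ := by
  have := intervalIntegral.norm_integral_le_of_norm_le_const (a := (0 : ℝ)) (b := h)
    (f := fun s => T.op s.toNNReal x) (C := M * ‖x‖) fun s hs => by
      refine (T.op _).le_of_opNorm_le (hM _ ?_) _
      rw [Set.uIoc_of_le h.coe_nonneg] at hs
      exact Real.toNNReal_le_iff_le_coe.2 hs.2
  refine this.trans (le_of_eq ?_)
  rw [sub_zero, abs_of_nonneg h.coe_nonneg]
  ring

section Complete

variable [CompleteSpace X]

theorem exists_norm_op_le_near_zero :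
    ∃ δ : ℝ≥0, 0 < δ ∧ ∃ M : ℝ, ∀ s ≤ δ, ‖T.op s‖ ≤ M := by
  by_contra! h
  choose s hs hsn using fun n : ℕ => h (1 / ((n : ℝ≥0) + 1)) (by positivity) n
  -- Orbits converge along `s`, so the uniform boundedness principle contradicts `‖T.op (s n)‖ > n`.
  have hs0 : Tendsto s atTop (𝓝 0) :=
    tendsto_of_tendsto_of_tendsto_of_le_of_le tendsto_const_nhds
      (tendsto_one_div_add_atTop_nhds_zero_nat (𝕜 := ℝ≥0)) (fun n => zero_le) hs
  obtain ⟨C, hC⟩ := banach_steinhaus (g := fun n => T.op (s n)) fun x => by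
    obtain ⟨C, -, hC⟩ := (((T.tendsto_op_nhds_zero x).comp
      hs0).totallyBounded_range).isBounded.exists_forall_range_norm_le
    exact ⟨C, hC⟩
  obtain ⟨n, hn⟩ := exists_nat_gt C
  exact absurd (hC n) (hn.trans (hsn n)).not_ge

theorem exists_norm_op_le (b : ℝ≥0) : ∃ M : ℝ, 0 < M ∧ ∀ s ≤ b, ‖T.op s‖ ≤ M := by
  obtain ⟨δ, hδ, M, hM⟩ := T.exists_norm_op_le_near_zero
  obtain ⟨n, hn⟩ := exists_nat_gt (b / δ)
  have hn0 : 0 < n := by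
    rcases Nat.eq_zero_or_pos n with rfl | h
    · simp at hn
    · exact h
  have hn' : (0 : ℝ≥0) < n := by exact_mod_cast hn0
  refine ⟨(|M| + 1) ^ n, by positivity, fun s hs => ?_⟩
  have h1 : s / n ≤ δ := by
    rw [div_le_iff₀ hn']
    rw [div_lt_iff₀ hδ] at hn
    exact hs.trans (hn.le.trans_eq (mul_comm _ _))
  have h2 : s = n • (s / n) := by
    rw [nsmul_eq_mul, mul_div_cancel₀ _ hn'.ne']
  rw [h2, op_nsmul]
  refine (norm_pow_le' _ hn0).trans ?_
  gcongr
  exact (hM _ h1).trans ((le_abs_self M).trans (by linarith))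

theorem continuous_op_apply (x : X) : Continuous fun t => T.op t x := by
  rw [continuous_iff_continuousAt]
  intro t
  obtain ⟨M, hM, h⟩ := T.exists_norm_op_le t
  rw [ContinuousAt, tendsto_iff_norm_sub_tendsto_zero]
  have hd : Tendsto (fun s => nndist s t) (𝓝 t) (𝓝 0) := by
    have : Continuous fun s => nndist s t := by fun_prop
    simpa using this.tendsto t
  have h1 : Tendsto (fun s => M * ‖T.op (nndist s t) x - x‖) (𝓝 t) (𝓝 0) := by
    simpa using ((((T.tendsto_op_nhds_zero x).comp hd).sub_const x).norm).const_mul M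
  refine squeeze_zero (fun _ => norm_nonneg _) (fun s => ?_) h1
  rw [norm_op_sub_op]
  exact (T.op _).le_of_opNorm_le (h _ (min_le_right _ _)) _

theorem continuous_op_toNNReal_apply (x : X) : Continuous fun t : ℝ => T.op t.toNNReal x :=
  (T.continuous_op_apply x).comp continuous_real_toNNReal

theorem intervalIntegrable_op (x : X) (a b : ℝ) :
    IntervalIntegrable (fun t : ℝ => T.op t.toNNReal x) MeasureTheory.volume a b :=
  (T.continuous_op_toNNReal_apply x).intervalIntegrable a b

/-- The operator `x ↦ ∫₀ʰ T(s) x ds`. -/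
noncomputable def integralOp (h : ℝ≥0) : X →L[ℂ] X :=
  LinearMap.mkContinuousOfExistsBound
    { toFun := fun x => ∫ s in (0 : ℝ)..h, T.op s.toNNReal x
      map_add' := fun x y => by
        simp_rw [map_add]
        exact intervalIntegral.integral_add (T.intervalIntegrable_op x _ _)
          (T.intervalIntegrable_op y _ _)
      map_smul' := fun c x => by
        simp_rw [map_smul]
        exact intervalIntegral.integral_smul c _ }
    (by
      obtain ⟨M, -, hM⟩ := T.exists_norm_op_le h
      exact ⟨h * M, T.norm_integral_op_le hM⟩)

theorem integralOp_apply (h : ℝ≥0) (x : X) :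
    T.integralOp h x = ∫ s in (0 : ℝ)..h, T.op s.toNNReal x :=
  rfl

theorem op_integralOp_comm (r h : ℝ≥0) (x : X) :
    T.op r (T.integralOp h x) = T.integralOp h (T.op r x) := by
  rw [integralOp_apply, ← (T.op r).intervalIntegral_comp_comm (T.intervalIntegrable_op x _ _),
    integralOp_apply]
  exact intervalIntegral.integral_congr fun s _ => T.op_comm r _ x

theorem op_integralOp (r h : ℝ≥0) (x : X) :
    T.op r (T.integralOp h x) = ∫ s in (r : ℝ)..(r + h : ℝ), T.op s.toNNReal x := by
  rw [integralOp_apply, ← (T.op r).intervalIntegral_comp_comm (T.intervalIntegrable_op x _ _)]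
  have := intervalIntegral.integral_comp_add_left (a := 0) (b := (h : ℝ))
    (fun s : ℝ => T.op s.toNNReal x) (r : ℝ)
  rw [add_zero] at this
  rw [← this]
  refine intervalIntegral.integral_congr fun s hs => ?_
  rw [Set.uIcc_of_le h.coe_nonneg] at hs
  rw [Real.toNNReal_add r.coe_nonneg hs.1, op_add_apply, Real.toNNReal_coe]

theorem hasDerivAt_integral_op (x : X) (a : ℝ) :
    HasDerivAt (fun u : ℝ => ∫ s in (0 : ℝ)..u, T.op s.toNNReal x) (T.op a.toNNReal x) a :=
  intervalIntegral.integral_hasDerivAt_right (T.intervalIntegrable_op x _ _)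
    ((T.continuous_op_toNNReal_apply x).stronglyMeasurableAtFilter _ _)
    (T.continuous_op_toNNReal_apply x).continuousAt

theorem tendsto_integralOp_div (x : X) :
    Tendsto (fun r : ℝ≥0 => (((r : ℝ) : ℂ))⁻¹ • T.integralOp r x) (𝓝[>] 0) (𝓝 x) := by
  have := (T.hasDerivAt_integral_op x 0).tendsto_complex_slope
  simpa [integralOp_apply] using this

theorem hasGenerator_integralOp (h : ℝ≥0) (x : X) :
    T.HasGenerator (T.integralOp h x) (T.op h x - x) := by
  have h1 := (T.hasDerivAt_integral_op x h).tendsto_complex_slope.sub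
    (T.hasDerivAt_integral_op x 0).tendsto_complex_slope
  rw [Real.toNNReal_coe, Real.toNNReal_zero, op_zero_apply] at h1
  refine h1.congr fun r => ?_
  rw [← smul_sub, op_integralOp, integralOp_apply, intervalIntegral.integral_same, sub_zero,
    zero_add, add_comm (h : ℝ) r, sub_right_comm]
  congr 2
  exact intervalIntegral.integral_interval_sub_left (T.intervalIntegrable_op x _ _)
    (T.intervalIntegrable_op x _ _)

theorem HasGenerator.op_sub_eq_integralOp {x y : X} (hxy : T.HasGenerator x y) (h : ℝ≥0) :
    T.op h x - x = T.integralOp h y := by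
  refine (T.hasGenerator_integralOp h x).unique T ?_
  refine (((T.integralOp h).continuous.tendsto y).comp hxy).congr fun r => ?_
  simp [T.op_integralOp_comm]

/-- The integrated equation involves only bounded operators, which exhibits the graph as an
intersection of closed sets. -/
theorem hasGenerator_iff_forall_op_sub_eq {x y : X} :
    T.HasGenerator x y ↔ ∀ h, T.op h x - x = T.integralOp h y := by
  refine ⟨fun hxy h => hxy.op_sub_eq_integralOp T h, fun H => ?_⟩
  refine (T.tendsto_integralOp_div y).congr fun r => ?_
  rw [H]

theorem isClosed_generatorGraph : IsClosed (T.generatorGraph : Set (X × X)) := by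
  have : (T.generatorGraph : Set (X × X)) =
      ⋂ h, {p | T.op h p.1 - p.1 = T.integralOp h p.2} := by
    ext p
    simp [mem_generatorGraph, hasGenerator_iff_forall_op_sub_eq]
  rw [this]
  exact isClosed_iInter fun h => isClosed_eq (by fun_prop) (by fun_prop)

instance : CompleteSpace T.generatorGraph :=
  T.isClosed_generatorGraph.completeSpace_coe

end Complete

/-! ### Rescaling, which turns `A - c` into a generator. -/

section Rescale

theorem HasGenerator.tendsto_exp_smul {x y : X} (h : T.HasGenerator x y) (c : ℂ) :
    Tendsto (fun r : ℝ≥0 => (((r : ℝ) : ℂ))⁻¹ • (Complex.exp (-(c * (r : ℝ))) • T.op r x - x))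
      (𝓝[>] 0) (𝓝 (y - c • x)) := by
  have hd : HasDerivAt (fun r : ℝ => Complex.exp (-(c * (r : ℝ)))) (-c) 0 := by
    have : HasDerivAt (fun r : ℝ => -(c * (r : ℂ))) (-c) 0 := by
      simpa using ((Complex.ofRealCLM.hasDerivAt (x := 0)).const_mul c).fun_neg
    simpa using this.cexp
  have h1 := hd.tendsto_complex_slope.smul_const x
  have h2 : Tendsto (fun r : ℝ≥0 => Complex.exp (-(c * (r : ℝ)))) (𝓝[>] 0) (𝓝 1) := by
    have : Continuous fun r : ℝ≥0 => Complex.exp (-(c * (r : ℝ))) := by fun_prop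
    simpa using (this.tendsto 0).mono_left nhdsWithin_le_nhds
  have h3 := (h2.smul h).add h1
  rw [one_smul, neg_smul, ← sub_eq_add_neg] at h3
  refine h3.congr fun r => ?_
  simp only [zero_add, Complex.ofReal_zero, mul_zero, neg_zero, Complex.exp_zero, smul_eq_mul,
    smul_sub, mul_smul, sub_smul, one_smul]
  rw [smul_comm]
  module

/-- The rescaled semigroup `e^{-cs} T(s)`. -/
noncomputable def rescale (c : ℂ) : C0Semigroup X where
  op s := Complex.exp (-(c * (s : ℝ))) • T.op s
  op_zero := by simp [T.op_zero]
  op_add s t := by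
    ext x
    simp only [T.op_add, smul_apply, ContinuousLinearMap.comp_apply, map_smul,
      smul_smul, ← Complex.exp_add]
    congr 2
    push_cast
    ring
  tendsto_zero x := by
    have h : Continuous fun r : ℝ≥0 => Complex.exp (-(c * (r : ℝ))) := by fun_prop
    simpa using ((h.tendsto 0).mono_left nhdsWithin_le_nhds).smul (T.tendsto_zero x)

theorem rescale_op_apply (c : ℂ) (s : ℝ≥0) (x : X) :
    (T.rescale c).op s x = Complex.exp (-(c * (s : ℝ))) • T.op s x :=
  rfl

theorem hasGenerator_rescale_iff {c : ℂ} {x y : X} :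
    (T.rescale c).HasGenerator x y ↔ T.HasGenerator x (y + c • x) := by
  constructor
  · intro h
    have := h.tendsto_exp_smul _ (-c)
    rw [neg_smul, sub_neg_eq_add] at this
    refine this.congr fun r => ?_
    rw [rescale_op_apply, smul_smul, ← Complex.exp_add]
    simp
  · intro h
    have := h.tendsto_exp_smul _ c
    rw [add_sub_cancel_right] at this
    exact this

end Rescale

/-! ### Eventual norm continuity. -/

section Differentiable

variable [CompleteSpace X]

/-- If `A T(a)` is bounded, then the semigroup is norm continuous from `a` on. -/
theorem continuous_op_add_of_hasGenerator {a : ℝ≥0} {B : X →L[ℂ] X}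
    (hB : ∀ x, T.HasGenerator (T.op a x) (B x)) : Continuous fun s => T.op (a + s) := by
  rw [continuous_iff_continuousAt]
  intro t
  obtain ⟨M, hM, h⟩ := T.exists_norm_op_le (t + 1)
  rw [ContinuousAt, tendsto_iff_norm_sub_tendsto_zero]
  have hd : Tendsto (fun s => dist s t) (𝓝 t) (𝓝 0) := by
    have : Continuous fun s => dist s t := by fun_prop
    simpa using this.tendsto t
  have h1 : Tendsto (fun s => M * (dist s t * M * ‖B‖)) (𝓝 t) (𝓝 0) := by
    simpa using ((hd.mul_const M).mul_const ‖B‖).const_mul M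
  refine squeeze_zero' (Eventually.of_forall fun _ => norm_nonneg _) ?_ h1
  have hev : ∀ᶠ s in 𝓝 t, dist s t < 1 := Metric.ball_mem_nhds t one_pos
  filter_upwards [hev] with s hs
  have hs' : nndist s t ≤ t + 1 := le_trans (by exact_mod_cast hs.le) le_add_self
  refine ContinuousLinearMap.opNorm_le_bound _ (by positivity) fun x => ?_
  -- With `d = |s - t|`, the difference is, up to sign, `T(min s t) (T(d) - 1) T(a) x`, and `(T(d) -
  -- 1) T(a) x` is the integral over `[0, d]` of the orbit of `B x`, hence O(d) uniformly on the
  -- unit ball.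
  rw [sub_apply, add_comm a s, add_comm a t, op_add_apply, op_add_apply,
    norm_op_sub_op, (hB x).op_sub_eq_integralOp]
  have h2 := T.norm_integral_op_le (fun r hr => h r (hr.trans hs')) (B x)
  calc ‖T.op (min s t) (T.integralOp (nndist s t) (B x))‖
      ≤ M * ‖T.integralOp (nndist s t) (B x)‖ :=
        (T.op _).le_of_opNorm_le (h _ ((min_le_right _ _).trans le_self_add)) _
    _ ≤ M * (dist s t * M * (‖B‖ * ‖x‖)) := by
        gcongr
        refine h2.trans ?_
        rw [coe_nndist]
        gcongr
        exact B.le_opNorm x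
    _ = _ := by ring

end Differentiable

end C0Semigroup

/-! ### Fourier coefficients of vector-valued functions. -/

section Fourier

theorem exists_dual_eq_zero_of_notMem_closure {Z : Type*} [NormedAddCommGroup Z] [NormedSpace ℂ Z]
    {S : Submodule ℂ Z} {z : Z} (hz : z ∉ closure (S : Set Z)) :
    ∃ l : Z →L[ℂ] ℂ, (∀ w ∈ S, l w = 0) ∧ l z ≠ 0 := by
  have hcl : IsClosed (S.topologicalClosure : Set Z) := S.isClosed_topologicalClosure
  obtain ⟨l, -, hl⟩ := exists_dual_vector'' ℂ (S.topologicalClosure.mkQ z)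
  refine ⟨l.comp S.topologicalClosure.mkQL, fun w hw => ?_, fun h => ?_⟩
  · have : S.topologicalClosure.mkQ w = 0 := by
      simpa using S.le_topologicalClosure hw
    exact (congrArg l this).trans (map_zero l)
  · have h' : l (S.topologicalClosure.mkQ z) = 0 := h
    rw [h'] at hl
    have h0 : S.topologicalClosure.mkQ z = 0 := by
      rw [← norm_eq_zero]
      exact RCLike.ofReal_eq_zero.1 hl.symm
    exact hz (by simpa [← Submodule.topologicalClosure_coe] using h0)

theorem ContinuousLinearMap.fourierCoeffOn_comp {Z : Type*} [NormedAddCommGroup Z]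
    [NormedSpace ℂ Z] [CompleteSpace Z] (l : Z →L[ℂ] ℂ) {f : ℝ → Z} (hf : Continuous f) {a b : ℝ}
    (hab : a < b) (k : ℤ) :
    fourierCoeffOn hab (fun s => l (f s)) k = l (fourierCoeffOn hab f k) := by
  have hint : IntervalIntegrable (fun x : ℝ => fourier (-k) (x : AddCircle (b - a)) • f x)
      MeasureTheory.volume a b := by
    refine Continuous.intervalIntegrable ?_ a b
    exact ((map_continuous (fourier (-k))).comp (AddCircle.continuous_mk' _)).smul hf
  rw [fourierCoeffOn_eq_integral, fourierCoeffOn_eq_integral, ← Complex.coe_smul,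
    ← Complex.coe_smul, map_smul, ← l.intervalIntegral_comp_comm hint]
  simp only [map_smul]

/-- Parseval gives a vanishing L² norm; continuity extends this to the end point. -/
theorem eq_zero_of_fourierCoeffOn_eq_zero {f : ℝ → ℂ} (hf : Continuous f) {a b : ℝ} (hab : a < b)
    (h : ∀ k, fourierCoeffOn hab f k = 0) : f a = 0 := by
  have hL2 : MeasureTheory.MemLp f 2 (MeasureTheory.volume.restrict (Set.Ioc a b)) := by
    obtain ⟨C, hC⟩ := isCompact_Icc.exists_bound_of_continuousOn (s := Set.Icc a b) hf.continuousOn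
    refine MeasureTheory.MemLp.of_bound hf.aestronglyMeasurable C ?_
    filter_upwards [MeasureTheory.ae_restrict_mem measurableSet_Ioc] with x hx
    exact hC x (Set.Ioc_subset_Icc_self hx)
  have hsum := hasSum_sq_fourierCoeffOn hab hL2
  simp only [h, norm_zero, ne_eq, OfNat.ofNat_ne_zero, not_false_eq_true, zero_pow] at hsum
  have h0 : ∫ x in a..b, ‖f x‖ ^ 2 = 0 := by
    have := hsum.unique hasSum_zero
    rw [smul_eq_mul, mul_eq_zero] at this
    exact this.resolve_left (inv_ne_zero (sub_pos.2 hab).ne')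
  by_contra hfa
  have hpos : 0 < ∫ x in a..b, ‖f x‖ ^ 2 :=
    intervalIntegral.integral_pos hab (by fun_prop) (fun x _ => by positivity)
      ⟨a, Set.left_mem_Icc.2 hab.le, by positivity⟩
  exact hpos.ne' h0

/-- A continuous function lies, at the left end point of an interval, in the closed span of its
Fourier coefficients on that interval. -/
theorem mem_closure_span_fourierCoeffOn {Z : Type*} [NormedAddCommGroup Z] [NormedSpace ℂ Z]
    [CompleteSpace Z] {f : ℝ → Z} (hf : Continuous f) {a b : ℝ} (hab : a < b) :
    f a ∈ closure (Submodule.span ℂ (Set.range fun k => fourierCoeffOn hab f k) : Set Z) := by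
  by_contra hz
  -- Hahn–Banach reduces to scalar functions. No Fourier series has to converge, so `f a` and `f b`
  -- may differ.
  obtain ⟨l, hl, hne⟩ := exists_dual_eq_zero_of_notMem_closure hz
  refine hne (eq_zero_of_fourierCoeffOn_eq_zero (l.continuous.comp hf) hab fun k => ?_)
  exact (l.fourierCoeffOn_comp hf hab k).trans (hl _ (Submodule.subset_span ⟨k, rfl⟩))

end Fourier

/-! ### Total boundedness under approximation. -/

section Approximation

theorem totallyBounded_range_of_forall_exists_approx {W : Type*} [NormedAddCommGroup W]
    {u : ℕ → W} (h : ∀ ε > 0, ∃ v : ℕ → W, TotallyBounded (Set.range v) ∧ ∀ n, ‖u n - v n‖ ≤ ε) :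
    TotallyBounded (Set.range u) := by
  rw [Metric.totallyBounded_iff]
  intro ε hε
  obtain ⟨v, hv, huv⟩ := h (ε / 2) (half_pos hε)
  obtain ⟨t, ht, htv⟩ := Metric.totallyBounded_iff.1 hv (ε / 2) (half_pos hε)
  refine ⟨t, ht, ?_⟩
  rintro _ ⟨n, rfl⟩
  obtain ⟨y, hy, hny⟩ := Set.mem_iUnion₂.1 (htv ⟨n, rfl⟩)
  refine Set.mem_iUnion₂.2 ⟨y, hy, ?_⟩
  rw [Metric.mem_ball] at hny ⊢
  calc dist (u n) y ≤ dist (u n) (v n) + dist (v n) y := dist_triangle _ _ _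
    _ < ε / 2 + ε / 2 := add_lt_add_of_le_of_lt (by rw [dist_eq_norm]; exact huv n) hny
    _ = ε := add_halves ε

/-- The good `z` form a closed subspace because the `Φ (y n)` are uniformly bounded. `Φ` will be
evaluation at vectors in the upper case and composition with functionals in the lower case. -/
theorem totallyBounded_range_apply_of_mem_closure_span {Y Z W : Type*} [NormedAddCommGroup Y]
    [NormedSpace ℂ Y] [NormedAddCommGroup Z] [NormedSpace ℂ Z] [NormedAddCommGroup W]
    [NormedSpace ℂ W] (Φ : Y →L[ℂ] Z →L[ℂ] W) {y : ℕ → Y}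
    (hy : Bornology.IsBounded (Set.range y)) {S : Set Z}
    (hS : ∀ z ∈ S, TotallyBounded (Set.range fun n => Φ (y n) z)) {z : Z}
    (hz : z ∈ closure (Submodule.span ℂ S : Set Z)) :
    TotallyBounded (Set.range fun n => Φ (y n) z) := by
  have hspan : ∀ w ∈ Submodule.span ℂ S, TotallyBounded (Set.range fun n => Φ (y n) w) := by
    intro w hw
    induction hw using Submodule.span_induction with
    | mem w hw => exact hS w hw
    | zero => simp [totallyBounded_singleton]
    | add w₁ w₂ _ _ h₁ h₂ => simpa using totallyBounded_range_add h₁ h₂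
    | smul c w _ h =>
      simpa using (c • ContinuousLinearMap.id ℂ W).totallyBounded_range_comp h
  obtain ⟨C, hC, hΦC⟩ := (Φ.isBounded_range_comp hy).exists_forall_range_norm_le
  refine totallyBounded_range_of_forall_exists_approx fun ε hε => ?_
  obtain ⟨w, hw, hzw⟩ := Metric.mem_closure_iff.1 hz (ε / C) (by positivity)
  refine ⟨_, hspan w hw, fun n => ?_⟩
  rw [← map_sub]
  calc ‖Φ (y n) (z - w)‖ ≤ C * ‖z - w‖ := (Φ (y n)).le_of_opNorm_le (hΦC n) _
    _ ≤ C * (ε / C) := by gcongr; rw [← dist_eq_norm]; exact hzw.le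
    _ = ε := by field_simp

end Approximation

/-! ### Comparison of `T(t) - e^{ct}` with `A - c`. -/

namespace C0Semigroup

variable {X : Type*} [NormedAddCommGroup X] [NormedSpace ℂ X] (T : C0Semigroup X)

/-- The generator, as a bounded operator on its graph. -/
def generatorOnGraph : T.generatorGraph →L[ℂ] X :=
  (ContinuousLinearMap.snd ℂ X X).comp T.generatorGraph.subtypeL

theorem op_sub_smul_apply_eq_smul (c : ℂ) (t : ℝ≥0) (x : X) :
    (T.op t - Complex.exp ((t : ℝ) * c) • ContinuousLinearMap.id ℂ X) x =
      Complex.exp ((t : ℝ) * c) • ((T.rescale c).op t x - x) := by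
  rw [rescale_op_apply, smul_sub, smul_smul, ← Complex.exp_add]
  rw [mul_comm c, add_neg_cancel, Complex.exp_zero, one_smul]
  rfl

/-- `P` is the geometric sum. Commutation is needed for functionals, where `V - μ` must stand on the
left. -/
theorem pow_smul_eq_add_geom_sum {V : X →L[ℂ] X} {μ : ℂ} (m : ℕ) :
    ∃ P : X →L[ℂ] X, Commute P (V - μ • ContinuousLinearMap.id ℂ X) ∧
      μ ^ m • ContinuousLinearMap.id ℂ X = V ^ m - P * (V - μ • ContinuousLinearMap.id ℂ X) := by
  have hc : Commute V (μ • (1 : X →L[ℂ] X)) := (Commute.one_right V).smul_right μ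
  refine ⟨∑ i ∈ Finset.range m, V ^ i * (μ • 1) ^ (m - 1 - i), ?_, ?_⟩
  · refine Commute.sum_left _ _ _ fun i _ => ?_
    have h1 : Commute V (V - μ • (1 : X →L[ℂ] X)) := (Commute.refl V).sub_right hc
    have h2 : Commute (μ • (1 : X →L[ℂ] X)) (V - μ • (1 : X →L[ℂ] X)) :=
      hc.symm.sub_right (Commute.refl _)
    exact (h1.pow_left i).mul_left (h2.pow_left _)
  · have := hc.geom_sum₂_mul m
    rw [smul_pow, one_pow] at this
    change μ ^ m • (1 : X →L[ℂ] X) = V ^ m - _ * (V - μ • (1 : X →L[ℂ] X))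
    rw [this, sub_sub_cancel]

theorem HasGenerator.op_of_rescale {c : ℂ} {x y : X} (h : (T.rescale c).HasGenerator x y)
    (t : ℝ≥0) : (T.rescale c).HasGenerator (T.op t x) (T.op t y) := by
  rw [hasGenerator_rescale_iff] at h ⊢
  simpa using h.op T t

variable [CompleteSpace X]

theorem op_mem_closure_span {a t : ℝ≥0} (ha : Continuous fun s => T.op (a + s)) (ht : 0 < t)
    (c : ℂ) :
    T.op a ∈ closure (Submodule.span ℂ (Set.range fun k : ℤ =>
      ((T.rescale (c + 2 * Real.pi * Complex.I * k / (t : ℝ))).integralOp t).comp (T.op a)) :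
        Set (X →L[ℂ] X)) := by
  let f : ℝ → X →L[ℂ] X := fun s => Complex.exp (-(c * s)) • T.op (a + s.toNNReal)
  have hf : Continuous f := by
    have he : Continuous fun s : ℝ => Complex.exp (-(c * s)) := by fun_prop
    exact he.smul (ha.comp continuous_real_toNNReal)
  have ht' : (0 : ℝ) < t := ht
  have h := mem_closure_span_fourierCoeffOn hf ht'
  have hf0 : f 0 = T.op a := by simp [f]
  rw [hf0] at h
  refine closure_mono ?_ h
  rw [SetLike.coe_subset_coe, Submodule.span_le]
  rintro _ ⟨k, rfl⟩
  -- The character `e^{-2πiks/t}` merges with `e^{-cs}`, shifting `c` by `2πik/t`.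
  have hk : fourierCoeffOn ht' f k = (((1 / ((t : ℝ) - 0) : ℝ)) : ℂ) •
      ((T.rescale (c + 2 * Real.pi * Complex.I * k / (t : ℝ))).integralOp t).comp (T.op a) := by
    rw [fourierCoeffOn_eq_integral, Complex.coe_smul]
    congr 1
    ext x
    have hint : IntervalIntegrable
        (fun x : ℝ => fourier (-k) (x : AddCircle ((t : ℝ) - 0)) • f x)
        MeasureTheory.volume 0 t := by
      refine Continuous.intervalIntegrable ?_ _ _
      exact ((map_continuous (fourier (-k))).comp (AddCircle.continuous_mk' _)).smul hf
    rw [ContinuousLinearMap.intervalIntegral_apply hint, ContinuousLinearMap.comp_apply,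
      integralOp_apply]
    refine intervalIntegral.integral_congr fun s hs => ?_
    rw [Set.uIcc_of_le t.coe_nonneg] at hs
    simp only [f, smul_apply, rescale_op_apply, fourier_coe_apply, smul_smul, ← Complex.exp_add]
    rw [Real.coe_toNNReal s hs.1, add_comm a, op_add_apply]
    congr 2
    push_cast
    ring
  simp only [hk]
  exact Submodule.smul_mem _ _ (Submodule.subset_span ⟨k, rfl⟩)

/-- From `e^{-ct} T(t) - 1 = J_c (A - c)`: first components of the graph sequence are handled by the
hypothesis, second components tend to zero. -/
theorem isSequentiallyProper_generatorOnGraph_of_op {c : ℂ} {t : ℝ≥0}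
    (h : (T.op t - Complex.exp ((t : ℝ) * c) • ContinuousLinearMap.id ℂ X).IsSequentiallyProper) :
    (T.rescale c).generatorOnGraph.IsSequentiallyProper := by
  intro p hp hp0
  have h1 : TotallyBounded (Set.range fun n => (p n : X × X).1) := by
    refine h _ (((ContinuousLinearMap.fst ℂ X X).comp
      (T.rescale c).generatorGraph.subtypeL).isBounded_range_comp hp) ?_
    have h2 := (((T.rescale c).integralOp t).continuous.tendsto 0).comp hp0
    rw [map_zero] at h2
    have h3 := h2.const_smul (Complex.exp ((t : ℝ) * c))
    rw [smul_zero] at h3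
    refine h3.congr fun n => ?_
    rw [op_sub_smul_apply_eq_smul, HasGenerator.op_sub_eq_integralOp _ (p n).2]
    rfl
  have h2 := totallyBounded_range_prod h1 hp0.totallyBounded_range
  refine totallyBounded_range_of_antilipschitz (K := 1)
    (f := (T.rescale c).generatorGraph.subtypeL)
    (AntilipschitzWith.of_le_mul_dist fun a b => by simp [Subtype.dist_eq]) h2

theorem finiteDimensional_quotient_range_generatorOnGraph_of_op {c : ℂ} {t : ℝ≥0}
    (h : FiniteDimensional ℂ (X ⧸ LinearMap.range
      ((T.op t - Complex.exp ((t : ℝ) * c) • ContinuousLinearMap.id ℂ X : X →L[ℂ] X) :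
        X →ₗ[ℂ] X))) :
    FiniteDimensional ℂ (X ⧸ LinearMap.range
      ((T.rescale c).generatorOnGraph : (T.rescale c).generatorGraph →ₗ[ℂ] X)) := by
  have hle : LinearMap.range
      ((T.op t - Complex.exp ((t : ℝ) * c) • ContinuousLinearMap.id ℂ X : X →L[ℂ] X) :
        X →ₗ[ℂ] X) ≤ LinearMap.range
      ((T.rescale c).generatorOnGraph : (T.rescale c).generatorGraph →ₗ[ℂ] X) := by
    rintro _ ⟨x, rfl⟩
    rw [ContinuousLinearMap.coe_coe, op_sub_smul_apply_eq_smul]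
    exact Submodule.smul_mem _ _ ⟨⟨(_, _), (T.rescale c).hasGenerator_integralOp t x⟩, rfl⟩
  exact Module.Finite.of_surjective (Submodule.factor hle) (Submodule.factor_surjective hle)

theorem exp_mul_add_two_pi_div {t : ℝ} (ht : t ≠ 0) (c : ℂ) (k : ℤ) :
    Complex.exp (t * (c + 2 * Real.pi * Complex.I * k / t)) = Complex.exp (t * c) := by
  have ht' : (t : ℂ) ≠ 0 := by exact_mod_cast ht
  rw [← Complex.exp_periodic.int_mul k (t * c)]
  congr 1
  field_simp

/-- The pairs `(D y, D' y)` lie in the graph of `A - c`, and `D'` is `e^{-ct} T(a) V`, so the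
hypothesis applies to `G (x n)`. -/
theorem totallyBounded_range_integralOp_op {c : ℂ} {t : ℝ≥0}
    (h : (T.rescale c).generatorOnGraph.IsSequentiallyProper) (a : ℝ≥0) {x : ℕ → X}
    (hx : Bornology.IsBounded (Set.range x))
    (hx0 : Tendsto (fun n => (T.op t - Complex.exp ((t : ℝ) * c) •
      ContinuousLinearMap.id ℂ X) (x n)) atTop (𝓝 0)) :
    TotallyBounded (Set.range fun n => (T.rescale c).integralOp t (T.op a (x n))) := by
  set V := T.op t - Complex.exp ((t : ℝ) * c) • ContinuousLinearMap.id ℂ X with hV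
  let D : X →L[ℂ] X := ((T.rescale c).integralOp t).comp (T.op a)
  let D' : X →L[ℂ] X := ((T.rescale c).op t - ContinuousLinearMap.id ℂ X).comp (T.op a)
  have hD' : ∀ y, D' y = (Complex.exp ((t : ℝ) * c))⁻¹ • T.op a (V y) := fun y => by
    have h1 : T.op a (V y) = V (T.op a y) := by simp [hV, T.op_comm t]
    rw [h1, hV, op_sub_smul_apply_eq_smul, inv_smul_smul₀ (Complex.exp_ne_zero _)]
    rfl
  let G : X →L[ℂ] (T.rescale c).generatorGraph :=
    (D.prod D').codRestrict _ fun y => (T.rescale c).hasGenerator_integralOp t (T.op a y)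
  have h1 := (((Complex.exp ((t : ℝ) * c))⁻¹ • T.op a).continuous.tendsto 0).comp hx0
  rw [map_zero] at h1
  have hG := h (fun n => G (x n)) (G.isBounded_range_comp hx)
    (h1.congr fun n => (hD' (x n)).symm)
  exact ((ContinuousLinearMap.fst ℂ X X).comp
    (T.rescale c).generatorGraph.subtypeL).totallyBounded_range_comp hG

/-- On the graph, `J_c T(a) (A - c) = e^{-ct} V T(a)`, so the dual of `A - c` sends `l n ∘ D` to a
null sequence. -/
theorem totallyBounded_range_comp_integralOp_op {c : ℂ} {t : ℝ≥0}
    (h : (ContinuousLinearMap.dualOperator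
      (T.rescale c).generatorOnGraph).IsSequentiallyProper) (a : ℝ≥0) {l : ℕ → X →L[ℂ] ℂ}
    (hl : Bornology.IsBounded (Set.range l))
    (hl0 : Tendsto (fun n => (l n).comp (T.op t - Complex.exp ((t : ℝ) * c) •
      ContinuousLinearMap.id ℂ X)) atTop (𝓝 0)) :
    TotallyBounded (Set.range fun n => (l n).comp
      (((T.rescale c).integralOp t).comp (T.op a))) := by
  set V := T.op t - Complex.exp ((t : ℝ) * c) • ContinuousLinearMap.id ℂ X with hV
  let D : X →L[ℂ] X := ((T.rescale c).integralOp t).comp (T.op a)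
  refine h (fun n => (l n).comp D)
    ((ContinuousLinearMap.dualOperator D).isBounded_range_comp hl) ?_
  let R : (T.rescale c).generatorGraph →L[ℂ] X := (Complex.exp ((t : ℝ) * c))⁻¹ •
    (T.op a).comp ((ContinuousLinearMap.fst ℂ X X).comp (T.rescale c).generatorGraph.subtypeL)
  have h1 := ((ContinuousLinearMap.dualOperator R).continuous.tendsto 0).comp hl0
  rw [map_zero] at h1
  refine h1.congr fun n => ?_
  ext p
  have h2 : D (p : X × X).2 = V (R p) := by
    have h3 : V (R p) = (Complex.exp ((t : ℝ) * c))⁻¹ • V (T.op a (p : X × X).1) :=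
      map_smul V _ _
    rw [h3, hV, op_sub_smul_apply_eq_smul, inv_smul_smul₀ (Complex.exp_ne_zero _),
      (HasGenerator.op_of_rescale T p.2 a).op_sub_eq_integralOp]
    rfl
  exact (congrArg (l n) h2).symm

theorem isSequentiallyProper_op_of_generatorOnGraph {t : ℝ≥0} (ht : 0 < t) {m : ℕ}
    (hcont : Continuous fun s => T.op (m • t + s)) (c : ℂ)
    (h : ∀ k : ℤ, (T.rescale (c + 2 * Real.pi * Complex.I * k /
      (t : ℝ))).generatorOnGraph.IsSequentiallyProper) :
    (T.op t - Complex.exp ((t : ℝ) * c) • ContinuousLinearMap.id ℂ X).IsSequentiallyProper := by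
  intro x hx hx0
  have ht' : (t : ℝ) ≠ 0 := by exact_mod_cast ht.ne'
  let A : X →L[ℂ] (X →L[ℂ] X) →L[ℂ] X := ContinuousLinearMap.apply ℂ X
  have hTm : TotallyBounded (Set.range fun n => A (x n) (T.op (m • t))) := by
    refine totallyBounded_range_apply_of_mem_closure_span A hx ?_
      (T.op_mem_closure_span hcont ht c)
    rintro _ ⟨k, rfl⟩
    refine T.totallyBounded_range_integralOp_op (h k) (m • t) hx ?_
    -- All shifts of `c` by `2πik/t` share the exponential `e^{tc}`.
    rw [exp_mul_add_two_pi_div ht']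
    exact hx0
  obtain ⟨P, -, hP⟩ := pow_smul_eq_add_geom_sum (V := T.op t) (μ := Complex.exp ((t : ℝ) * c)) m
  have h1 : TotallyBounded (Set.range fun n => Complex.exp ((t : ℝ) * c) ^ m • x n) := by
    refine totallyBounded_range_of_sub_tendsto_zero hTm ?_
    have h2 := ((-P).continuous.tendsto 0).comp hx0
    rw [map_zero] at h2
    refine h2.congr fun n => ?_
    have h3 : Complex.exp ((t : ℝ) * c) ^ m • x n = _ := congrArg (fun S : X →L[ℂ] X => S (x n)) hP
    have h4 : A (x n) (T.op (m • t)) = (T.op t ^ m) (x n) := by rw [op_nsmul]; rfl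
    rw [h3, h4, sub_apply, sub_sub_cancel_left]
    rfl
  have h2 := ((Complex.exp ((t : ℝ) * c) ^ m)⁻¹ •
    ContinuousLinearMap.id ℂ X).totallyBounded_range_comp h1
  simpa [smul_smul, Complex.exp_ne_zero] using h2

theorem isSequentiallyProper_dualOperator_op_of_generatorOnGraph {t : ℝ≥0} (ht : 0 < t) {m : ℕ}
    (hcont : Continuous fun s => T.op (m • t + s)) (c : ℂ)
    (h : ∀ k : ℤ, (ContinuousLinearMap.dualOperator (T.rescale (c + 2 * Real.pi * Complex.I * k /
      (t : ℝ))).generatorOnGraph).IsSequentiallyProper) :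
    (ContinuousLinearMap.dualOperator (T.op t - Complex.exp ((t : ℝ) * c) •
      ContinuousLinearMap.id ℂ X)).IsSequentiallyProper := by
  intro l hl hl0
  have ht' : (t : ℝ) ≠ 0 := by exact_mod_cast ht.ne'
  let A : (X →L[ℂ] ℂ) →L[ℂ] (X →L[ℂ] X) →L[ℂ] (X →L[ℂ] ℂ) := ContinuousLinearMap.compL ℂ X X ℂ
  have hTm : TotallyBounded (Set.range fun n => A (l n) (T.op (m • t))) := by
    refine totallyBounded_range_apply_of_mem_closure_span A hl ?_
      (T.op_mem_closure_span hcont ht c)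
    rintro _ ⟨k, rfl⟩
    refine T.totallyBounded_range_comp_integralOp_op (t := t) (h k) (m • t) hl ?_
    rw [exp_mul_add_two_pi_div ht']
    exact hl0
  obtain ⟨P, hPc, hP⟩ :=
    pow_smul_eq_add_geom_sum (V := T.op t) (μ := Complex.exp ((t : ℝ) * c)) m
  rw [hPc.eq] at hP
  have h1 : TotallyBounded (Set.range fun n => Complex.exp ((t : ℝ) * c) ^ m • l n) := by
    refine totallyBounded_range_of_sub_tendsto_zero hTm ?_
    have h2 := ((-(ContinuousLinearMap.dualOperator P)).continuous.tendsto 0).comp hl0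
    rw [map_zero] at h2
    refine h2.congr fun n => ?_
    ext x
    have h3 : Complex.exp ((t : ℝ) * c) ^ m • l n x = _ :=
      (map_smul (l n) _ x).symm.trans (congrArg (fun S : X →L[ℂ] X => l n (S x)) hP)
    have h4 : A (l n) (T.op (m • t)) x = l n ((T.op t ^ m) x) := by rw [op_nsmul]; rfl
    rw [sub_apply, smul_apply, h3, h4, sub_apply, map_sub, sub_sub_cancel_left]
    rfl
  have h2 := ((Complex.exp ((t : ℝ) * c) ^ m)⁻¹ •
    ContinuousLinearMap.id ℂ (X →L[ℂ] ℂ)).totallyBounded_range_comp h1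
  simpa [smul_smul, Complex.exp_ne_zero] using h2

end C0Semigroup

/-! ### Transfer to partially defined operators. -/

namespace LinearPMap

variable {X : Type*} [NormedAddCommGroup X] [NormedSpace ℂ X] {E : Type*} [NormedAddCommGroup E]
  [NormedSpace ℂ E]

theorem range_eq_of_equiv {A : X →ₗ.[ℂ] X} {f : E →L[ℂ] X} (j : E ≃ₗ[ℂ] A.domain)
    (hj : ∀ e, A.toFun (j e) = f e) :
    LinearMap.range A.toFun = LinearMap.range (f : E →ₗ[ℂ] X) := by
  ext y
  constructor
  · rintro ⟨x, rfl⟩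
    exact ⟨j.symm x, by rw [ContinuousLinearMap.coe_coe, ← hj, j.apply_symm_apply]⟩
  · rintro ⟨e, rfl⟩
    exact ⟨j e, hj e⟩

theorem isLowerSemiFredholm_iff_of_equiv {A : X →ₗ.[ℂ] X} {f : E →L[ℂ] X} (j : E ≃ₗ[ℂ] A.domain)
    (hj : ∀ e, A.toFun (j e) = f e) :
    A.IsLowerSemiFredholm ↔ FiniteDimensional ℂ (X ⧸ LinearMap.range (f : E →ₗ[ℂ] X)) := by
  rw [IsLowerSemiFredholm, range_eq_of_equiv j hj]

theorem isUpperSemiFredholm_iff_of_equiv [CompleteSpace X] [CompleteSpace E] {A : X →ₗ.[ℂ] X}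
    {f : E →L[ℂ] X} (j : E ≃ₗ[ℂ] A.domain) (hj : ∀ e, A.toFun (j e) = f e) :
    A.IsUpperSemiFredholm ↔ f.IsSequentiallyProper := by
  have hker : LinearMap.ker (f : E →ₗ[ℂ] X) =
      (LinearMap.ker A.toFun).comap (j : E →ₗ[ℂ] A.domain) := by
    ext e
    simp [← hj]
  have e : LinearMap.ker (f : E →ₗ[ℂ] X) ≃ₗ[ℂ] LinearMap.ker A.toFun :=
    (LinearEquiv.ofEq _ _ hker).trans (j.ofSubmodule' _)
  rw [IsUpperSemiFredholm, range_eq_of_equiv j hj, ContinuousLinearMap.isSequentiallyProper_iff]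
  exact and_congr_left fun _ => ⟨fun _ => e.symm.finiteDimensional, fun _ => e.finiteDimensional⟩

end LinearPMap

namespace ContinuousLinearMap

variable {X : Type*} [NormedAddCommGroup X] [NormedSpace ℂ X] (S : X →L[ℂ] X) (c : ℂ)

theorem isUpperSemiFredholm_subScalar_iff [CompleteSpace X] :
    (S.toFullPMap.subScalar c).IsUpperSemiFredholm ↔
      (S - c • ContinuousLinearMap.id ℂ X).IsSequentiallyProper :=
  LinearPMap.isUpperSemiFredholm_iff_of_equiv
    (A := S.toFullPMap.subScalar c) Submodule.topEquiv.symm fun _ => rfl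

theorem isLowerSemiFredholm_subScalar_iff :
    (S.toFullPMap.subScalar c).IsLowerSemiFredholm ↔ FiniteDimensional ℂ (X ⧸ LinearMap.range
      ((S - c • ContinuousLinearMap.id ℂ X : X →L[ℂ] X) : X →ₗ[ℂ] X)) :=
  LinearPMap.isLowerSemiFredholm_iff_of_equiv
    (A := S.toFullPMap.subScalar c) Submodule.topEquiv.symm fun _ => rfl

end ContinuousLinearMap

/-! ### Spectral inclusions for the generator and the semigroup. -/

namespace C0Semigroup

variable {X : Type*} [NormedAddCommGroup X] [NormedSpace ℂ X] (T : C0Semigroup X)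

theorem generator_apply_eq {x y : X} (h : T.HasGenerator x y) (hx : x ∈ T.generator.domain) :
    T.generator ⟨x, hx⟩ = y :=
  (T.generator_spec ⟨x, hx⟩).unique T h

theorem exists_equiv_generatorGraph_rescale (c : ℂ) :
    ∃ j : (T.rescale c).generatorGraph ≃ₗ[ℂ] (T.generator.subScalar c).domain,
      ∀ p, (T.generator.subScalar c).toFun (j p) = (T.rescale c).generatorOnGraph p := by
  have hgen : ∀ p : (T.rescale c).generatorGraph,
      T.HasGenerator (p : X × X).1 ((p : X × X).2 + c • (p : X × X).1) := fun p =>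
    T.hasGenerator_rescale_iff.1 p.2
  let j : (T.rescale c).generatorGraph →ₗ[ℂ] (T.generator.subScalar c).domain :=
    ((LinearMap.fst ℂ X X).comp (T.rescale c).generatorGraph.subtype).codRestrict
      (T.generator.subScalar c).domain fun p => ⟨_, hgen p⟩
  have hj : Function.Bijective j := by
    constructor
    · intro p q hpq
      have h1 : (p : X × X).1 = (q : X × X).1 := congrArg Subtype.val hpq
      refine Subtype.ext (Prod.ext h1 ?_)
      have h2 : (T.rescale c).HasGenerator (p : X × X).1 (p : X × X).2 := p.2
      rw [h1] at h2
      exact h2.unique (T.rescale c) q.2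
    · intro x
      obtain ⟨y, hy⟩ := (show (x : X) ∈ T.generator.domain from x.2)
      refine ⟨⟨((x : X), y - c • (x : X)), ?_⟩, rfl⟩
      refine T.hasGenerator_rescale_iff.2 ?_
      simpa using hy
  refine ⟨LinearEquiv.ofBijective j hj, fun p => ?_⟩
  have h : T.generator ⟨(p : X × X).1, ⟨_, hgen p⟩⟩ = _ := T.generator_apply_eq (hgen p) _
  change T.generator ⟨(p : X × X).1, ⟨_, hgen p⟩⟩ - c • (p : X × X).1 = (p : X × X).2
  rw [h, add_sub_cancel_right]

theorem isLowerSemiFredholm_generator_iff (c : ℂ) :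
    (T.generator.subScalar c).IsLowerSemiFredholm ↔ FiniteDimensional ℂ (X ⧸ LinearMap.range
      ((T.rescale c).generatorOnGraph : (T.rescale c).generatorGraph →ₗ[ℂ] X)) := by
  obtain ⟨j, hj⟩ := T.exists_equiv_generatorGraph_rescale c
  exact LinearPMap.isLowerSemiFredholm_iff_of_equiv j hj

variable [CompleteSpace X]

theorem isUpperSemiFredholm_generator_iff (c : ℂ) :
    (T.generator.subScalar c).IsUpperSemiFredholm ↔
      (T.rescale c).generatorOnGraph.IsSequentiallyProper := by
  obtain ⟨j, hj⟩ := T.exists_equiv_generatorGraph_rescale c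
  exact LinearPMap.isUpperSemiFredholm_iff_of_equiv j hj

theorem isUpperSemiFredholm_generator_of_op {c : ℂ} {t : ℝ≥0}
    (h : ((T.op t).toFullPMap.subScalar (Complex.exp ((t : ℝ) * c))).IsUpperSemiFredholm) :
    (T.generator.subScalar c).IsUpperSemiFredholm :=
  (T.isUpperSemiFredholm_generator_iff c).2 (T.isSequentiallyProper_generatorOnGraph_of_op
    (((T.op t).isUpperSemiFredholm_subScalar_iff _).1 h))

theorem isLowerSemiFredholm_generator_of_op {c : ℂ} {t : ℝ≥0}
    (h : ((T.op t).toFullPMap.subScalar (Complex.exp ((t : ℝ) * c))).IsLowerSemiFredholm) :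
    (T.generator.subScalar c).IsLowerSemiFredholm :=
  (T.isLowerSemiFredholm_generator_iff c).2
    (T.finiteDimensional_quotient_range_generatorOnGraph_of_op
      (((T.op t).isLowerSemiFredholm_subScalar_iff _).1 h))

/-- A multiple of `t` beyond `t₀` is used so that `T(mt) = T(t)^m` can be compared with `μ^m`. -/
theorem exists_nsmul_continuous_op_add {t₀ t : ℝ≥0} (ht : 0 < t) {B : X →L[ℂ] X}
    (hB : ∀ x, T.HasGenerator (T.op t₀ x) (B x)) :
    ∃ m : ℕ, Continuous fun s => T.op (m • t + s) := by
  obtain ⟨m, hm⟩ := Archimedean.arch t₀ ht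
  exact ⟨m, T.continuous_op_add_of_le hm (T.continuous_op_add_of_hasGenerator hB)⟩

theorem exists_exp_mul_eq {t : ℝ≥0} (ht : 0 < t) {μ : ℂ} (hμ : μ ≠ 0) :
    ∃ c : ℂ, Complex.exp ((t : ℝ) * c) = μ := by
  have ht' : ((t : ℝ) : ℂ) ≠ 0 := by exact_mod_cast ht.ne'
  exact ⟨Complex.log μ / (t : ℝ), by rw [mul_div_cancel₀ _ ht', Complex.exp_log hμ]⟩

theorem isUpperSemiFredholm_op {t₀ t : ℝ≥0} (ht : 0 < t) {B : X →L[ℂ] X}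
    (hB : ∀ x, T.HasGenerator (T.op t₀ x) (B x)) {μ : ℂ} (hμ : μ ≠ 0)
    (h : ∀ z : ℂ, Complex.exp ((t : ℝ) * z) = μ → (T.generator.subScalar z).IsUpperSemiFredholm) :
    ((T.op t).toFullPMap.subScalar μ).IsUpperSemiFredholm := by
  obtain ⟨c, rfl⟩ := exists_exp_mul_eq ht hμ
  obtain ⟨m, hm⟩ := T.exists_nsmul_continuous_op_add ht hB
  rw [ContinuousLinearMap.isUpperSemiFredholm_subScalar_iff]
  refine T.isSequentiallyProper_op_of_generatorOnGraph ht hm c fun k => ?_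
  rw [← isUpperSemiFredholm_generator_iff]
  exact h _ (exp_mul_add_two_pi_div (by exact_mod_cast ht.ne') c k)

theorem isLowerSemiFredholm_op {t₀ t : ℝ≥0} (ht : 0 < t) {B : X →L[ℂ] X}
    (hB : ∀ x, T.HasGenerator (T.op t₀ x) (B x)) {μ : ℂ} (hμ : μ ≠ 0)
    (h : ∀ z : ℂ, Complex.exp ((t : ℝ) * z) = μ → (T.generator.subScalar z).IsLowerSemiFredholm) :
    ((T.op t).toFullPMap.subScalar μ).IsLowerSemiFredholm := by
  obtain ⟨c, rfl⟩ := exists_exp_mul_eq ht hμ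
  obtain ⟨m, hm⟩ := T.exists_nsmul_continuous_op_add ht hB
  rw [ContinuousLinearMap.isLowerSemiFredholm_subScalar_iff,
    ← ContinuousLinearMap.isSequentiallyProper_dualOperator_iff]
  refine T.isSequentiallyProper_dualOperator_op_of_generatorOnGraph ht hm c fun k => ?_
  rw [ContinuousLinearMap.isSequentiallyProper_dualOperator_iff,
    ← isLowerSemiFredholm_generator_iff]
  exact h _ (exp_mul_add_two_pi_div (by exact_mod_cast ht.ne') c k)

end C0Semigroup

theorem Complex.setOf_not_sdiff_zero_eq_image_exp {p q : ℂ → Prop} {t : ℂ}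
    (hpq : ∀ z, p (Complex.exp (t * z)) → q z)
    (hqp : ∀ μ, μ ≠ 0 → (∀ z, Complex.exp (t * z) = μ → q z) → p μ) :
    {μ | ¬ p μ} \ {0} = (fun z => Complex.exp (t * z)) '' {z | ¬ q z} := by
  ext μ
  constructor
  · rintro ⟨hμ, hμ0⟩
    by_contra h
    refine hμ (hqp μ hμ0 fun z hz => ?_)
    by_contra hq
    exact h ⟨z, hq, hz⟩
  · rintro ⟨z, hz, rfl⟩
    exact ⟨fun h => hz (hpq z h), Complex.exp_ne_zero _⟩

theorem mainTheorem1 {X : Type*} [NormedAddCommGroup X] [NormedSpace ℂ X] [CompleteSpace X]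
    (T : C0Semigroup X)
    -- the operator `A T(t₀)` is everywhere defined and bounded for some `t₀ > 0`
    (hT : ∃ t₀ : ℝ≥0, 0 < t₀ ∧ ∃ B : X →L[ℂ] X, ∀ x : X,
      ∃ hx : T.op t₀ x ∈ T.generator.domain, T.generator ⟨T.op t₀ x, hx⟩ = B x) :
    (∀ t : ℝ≥0, 0 < t →
      (T.op t).toFullPMap.upperSemiFredholmSpectrum \ {0} =
        (fun z : ℂ => Complex.exp (((t : ℝ) : ℂ) * z)) '' T.generator.upperSemiFredholmSpectrum) ∧
    (IsReflexiveSpace X → ∀ t : ℝ≥0, 0 < t →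
      (T.op t).toFullPMap.lowerSemiFredholmSpectrum \ {0} =
        (fun z : ℂ => Complex.exp (((t : ℝ) : ℂ) * z)) '' T.generator.lowerSemiFredholmSpectrum ∧
      (T.op t).toFullPMap.essentialSpectrum \ {0} =
        (fun z : ℂ => Complex.exp (((t : ℝ) : ℂ) * z)) '' T.generator.essentialSpectrum) := by
  obtain ⟨t₀, -, B, hB⟩ := hT
  have hB' : ∀ x, T.HasGenerator (T.op t₀ x) (B x) := fun x => by
    obtain ⟨hx, h⟩ := hB x
    rw [← h]
    exact T.generator_spec ⟨_, hx⟩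
  refine ⟨fun t ht => ?_, fun _ t ht => ⟨?_, ?_⟩⟩
  · exact Complex.setOf_not_sdiff_zero_eq_image_exp
      (fun _ => T.isUpperSemiFredholm_generator_of_op) fun _ => T.isUpperSemiFredholm_op ht hB'
  · exact Complex.setOf_not_sdiff_zero_eq_image_exp
      (fun _ => T.isLowerSemiFredholm_generator_of_op) fun _ => T.isLowerSemiFredholm_op ht hB'
  · exact Complex.setOf_not_sdiff_zero_eq_image_exp
      (fun _ h => ⟨T.isUpperSemiFredholm_generator_of_op h.1,
        T.isLowerSemiFredholm_generator_of_op h.2⟩)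
      fun _ hμ h => ⟨T.isUpperSemiFredholm_op ht hB' hμ fun z hz => (h z hz).1,
        T.isLowerSemiFredholm_op ht hB' hμ fun z hz => (h z hz).2⟩
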